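/- Let $\mathbb{F}$ be an arbitrary field, let $\overline{\mathbb{F}}$ be an algebraic closure of $\mathbb{F}$, and let $p,q\in\mathbb{F}[t]$ be monic polynomials of degree $2$. For a monic polynomial $r=t^2-at+b$ put $\operatorname{tr} r:=a$. Let $F_{p,q}(t):=\operatorname{res}_{\mathbb{F}[t]}\bigl(p(x),q(x-t)\bigr)\in\mathbb{F}[t]$, the resultant being taken with respect to $x$; thus $F_{p,q}(t)=\prod_{1\le i,j\le 2}\bigl(t-(x_i-y_j)\bigr)$, where $x_1,x_2$ and $y_1,y_2$ are the roots of $p$ and of $q$ in $\overline{\mathbb{F}}$, counted with multiplicities. An endomorphism $v$ of a finite-dimensional $\mathbb{F}$-vector space $V$ is called $(p,q)$-exceptional if $V=\bigcup_{n\in\mathbb{N}}\operatorname{Ker} F_{p,q}(v)^n$. A symplectic pair $(b,u)$ on a vector space $W$ consists of a nondegenerate alternating bilinear form $b$ on $W$ and of an endomorphism $u$ of $W$ that is $b$-alternating, i.e. $b(x,u(x))=0$ for all $x\in W$. It is called a symplectic $(p,q)$-difference if there exist $b$-alternating endomorphisms $u_1,u_2$ of $W$ such that $p(u_1)=q(u_2)=0$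 and $u=u_1-u_2$. The symplectic extension $S(v)$ of an endomorphism $v$ of $V$ is the symplectic pair on $V\times V^\star$ given by the form $\bigl((x,\varphi),(y,\psi)\bigr)\mapsto\varphi(y)-\psi(x)$ and the endomorphism $(x,\varphi)\mapsto(v(x),\varphi\circ v)$. **Theorem.** Assume that $p$ and $q$ are irreducible over $\mathbb{F}$ with distinct splitting fields in $\overline{\mathbb{F}}$. Assume furthermore that $\operatorname{char}(\mathbb{F})\neq 2$, or $\operatorname{tr} p=\operatorname{tr} q=0$, or $\operatorname{tr} p\neq\operatorname{tr} q$. Then, for every $(p,q)$-exceptional endomorphism $v$ of a finite-dimensional $\mathbb{F}$-vector space, the symplectic pair $S(v)$ is a symplectic $(p,q)$-difference. -/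

import Mathlib

open Polynomial

/-- A symplectic pair `(b, u)` on `V`: a nondegenerate alternating bilinear form `b` together with
a `b`-alternating endomorphism `u`. -/
structure SymplecticPair (F V : Type*) [Field F] [AddCommGroup V] [Module F V] where
  form : LinearMap.BilinForm F V
  endo : Module.End F V
  form_alt : form.IsAlt
  form_nondegenerate : form.Nondegenerate
  endo_alt : ∀ x, form x (endo x) = 0

/-- `(b, u)` is a symplectic `(p, q)`-difference: `u = u₁ - u₂` for some `b`-alternating
endomorphisms `u₁` and `u₂` with `p(u₁) = q(u₂) = 0`. -/
def SymplecticPair.IsDifference {F V : Type*} [Field F] [AddCommGroup V] [Module F V]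
    (P : SymplecticPair F V) (p q : F[X]) : Prop :=
  ∃ u₁ u₂ : Module.End F V,
    (∀ x, P.form x (u₁ x) = 0) ∧ (∀ x, P.form x (u₂ x) = 0) ∧
      aeval u₁ p = 0 ∧ aeval u₂ q = 0 ∧ P.endo = u₁ - u₂

/-- The standard symplectic form on `V × V*`: `((x, φ), (y, ψ)) ↦ φ(y) - ψ(x)`. -/
def stdSymplecticForm (F V : Type*) [Field F] [AddCommGroup V] [Module F V] :
    LinearMap.BilinForm F (V × Module.Dual F V) :=
  LinearMap.mk₂ F (fun a b => a.2 b.1 - b.2 a.1)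
    (fun a a' b => by simp; ring) (fun c a b => by simp; ring)
    (fun a b b' => by simp; ring) (fun c a b => by simp; ring)

/-- The symplectic extension `S(v) = (S_V, v ⊕ vᵗ)` of an endomorphism `v` of `V`, a symplectic
pair on `V × V*`. -/
def symplecticExtension {F V : Type*} [Field F] [AddCommGroup V] [Module F V]
    (v : Module.End F V) : SymplecticPair F (V × Module.Dual F V) where
  form := stdSymplecticForm F V
  endo := LinearMap.prodMap v (LinearMap.dualMap v)
  form_alt := fun a => by simp [stdSymplecticForm]
  form_nondegenerate := by
    have key : ∀ a : V × Module.Dual F V,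
        (∀ b : V × Module.Dual F V, a.2 b.1 - b.2 a.1 = 0) → a = 0 := by
      rintro ⟨x, φ⟩ h
      refine Prod.ext ?_ ?_
      · exact (Module.forall_dual_apply_eq_zero_iff F x).1 fun ψ => by simpa using h (0, ψ)
      · ext y
        simpa using h (y, 0)
    refine ⟨fun a h => key a fun b => h b, fun a h => key a fun b => ?_⟩
    have := h b
    simp only [stdSymplecticForm, LinearMap.mk₂_apply] at this
    linear_combination -this
  endo_alt := fun a => by simp [stdSymplecticForm]

/-- The trace of a monic polynomial of degree `n > 0`: the opposite of its coefficient on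
`t ^ (n - 1)`. -/
def polyTrace {F : Type*} [Field F] (p : F[X]) : F :=
  -p.nextCoeff

/-- The fundamental polynomial `F_{p,q}(t) = res (p(x), q(x - t))`, the resultant being taken
with respect to `x` over the ring `F[t]`. Here the outer variable of `F[X][X]` is `x` and the
inner one is `t`. -/
noncomputable def fundamentalPoly {F : Type*} [Field F] (p q : F[X]) : F[X] :=
  resultant (p.map (C : F →+* F[X])) ((q.map (C : F →+* F[X])).comp (X - C X))

/-- The subspace `E_{p,q}(u)`, the (increasing) union of the kernels of the `F_{p,q}(u) ^ n`. -/
noncomputable def exceptionalPart {F V : Type*} [Field F] [AddCommGroup V] [Module F V]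
    (p q : F[X]) (u : Module.End F V) : Submodule F V :=
  ⨆ n : ℕ, LinearMap.ker (aeval u (fundamentalPoly p q) ^ n)

/-- `u` is `(p, q)`-exceptional: `E_{p,q}(u) = V`. -/
def IsExceptional {F V : Type*} [Field F] [AddCommGroup V] [Module F V]
    (p q : F[X]) (u : Module.End F V) : Prop :=
  exceptionalPart p q u = ⊤

/-- The splitting field of `p` inside an extension `K` of `F` in which `p` splits: the subfield
generated over `F` by the roots of `p` in `K`. -/
def splittingFieldIn {F : Type*} [Field F] (K : Type*) [Field K] [Algebra F K] (p : F[X]) :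
    IntermediateField F K :=
  IntermediateField.adjoin F (p.rootSet K)

/-! Put δ = tr p - tr q. The involution θ ↦ δ - θ permutes the differences of roots, so F_{p,q} is a
polynomial in t² - δt (`fundamentalPoly_eq`). The splitting fields being distinct, the trace
condition makes it a power of one irreducible ρ(t² - δt) (`exists_fundamentalPoly_eq_pow`). An
exceptional v thus splits into blocks F[t]/(ρ(t² - δt)^k), each free with basis 1, t over
F[z]/(ρ^k), where z = t² - δt. So v is multiplication by t on R[t]/(t² - δt - ω), with R a product
of Frobenius algebras (`exists_frobenius_model`).

The Frobenius form yields a symmetric form for which v is self-adjoint, which identifies v with its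
transpose. Then S(v) is two copies of v, and u₁ is an explicit matrix over R
(`symplecticExtension_isDifference_of_equiv`). -/

/-- If `v` is similar to multiplication by `t` on `R[t] / (t ^ 2 - δ t - ω)`, where `R` is a
Frobenius algebra, then `S(v)` is a symplectic difference. -/
theorem symplecticExtension_isDifference_of_equiv {F R V : Type*} [Field F] [CommRing R]
    [Algebra F R] [AddCommGroup V] [Module F V] [FiniteDimensional F V]
    (a b c d : F) (ω : R) (l : R →ₗ[F] F) (hl : ∀ x, (∀ y, l (x * y) = 0) → x = 0)
    (v : Module.End F V) (e : (R × R) ≃ₗ[F] V)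
    (he : ∀ x y, v (e (x, y)) = e (ω * y, x + (a - c) • y)) :
    (symplecticExtension v).IsDifference (X ^ 2 - C a * X + C b) (X ^ 2 - C c * X + C d) := by
  -- Reading (x, y) as x + yt, this is `l` of the t-coefficient of the product, so multiplication by
  -- t is self-adjoint.
  let β : (R × R) →ₗ[F] (R × R) →ₗ[F] F :=
    LinearMap.mk₂ F (fun s t => l (s.1 * t.2 + s.2 * t.1 + (a - c) • (s.2 * t.2)))
      (fun s s' t => by rw [← map_add]; congr 1; simp [add_mul]; abel)
      (fun k s t => by rw [← map_smul]; congr 1; simp [smul_comm k])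
      (fun s t t' => by rw [← map_add]; congr 1; simp [mul_add]; abel)
      (fun k s t => by rw [← map_smul]; congr 1; simp [smul_comm k])
  have hβ : ∀ s t, β s t = l (s.1 * t.2 + s.2 * t.1 + (a - c) • (s.2 * t.2)) := fun _ _ => rfl
  let ψ : (R × R) →ₗ[F] Module.Dual F V := β.compl₂ e.symm.toLinearMap
  have hψ : ∀ s x, ψ s x = β s (e.symm x) := fun _ _ => rfl
  have : FiniteDimensional F (R × R) := e.symm.finiteDimensional
  have hinj : Function.Injective ψ := by
    rw [injective_iff_map_eq_zero]
    rintro ⟨x, y⟩ h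
    have h' : ∀ t, β (x, y) t = 0 := fun t => by
      have := congrArg (fun f => f (e t)) h
      simpa [hψ] using this
    have hy : y = 0 := hl y fun z => by simpa [hβ] using h' (z, 0)
    have hx : x = 0 := hl x fun z => by simpa [hβ, hy] using h' (0, z)
    rw [hx, hy]; rfl
  let ψe : (R × R) ≃ₗ[F] Module.Dual F V := LinearEquiv.ofInjectiveOfFinrankEq ψ hinj (by
    rw [Subspace.dual_finrank_eq, e.finrank_eq])
  let E : ((R × R) × (R × R)) ≃ₗ[F] (V × Module.Dual F V) := e.prodCongr ψe
  -- On the basis e₁, e₂ over R[t]/(t² - δt - ω), `w` is the companion matrix of p: e₁ ↦ e₂, e₂ ↦ -b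
  -- e₁ + a e₂. It is extended by wu + uw = δw + au + ω - (b - d), which, given p(w) = 0 and u² = δu
  -- + ω, says exactly q(w - u) = 0.
  let w : Module.End F ((R × R) × (R × R)) :=
    { toFun := fun s =>
        (((ω - algebraMap F R (b - d)) * s.1.2 - b • (s.2.1 + (a - c) • s.2.2),
          a • s.1.2 + b • s.2.2),
         (s.1.1 + (a - c) • s.1.2 + (ω - algebraMap F R (b - d)) * s.2.2
            + a • (s.2.1 + (a - c) • s.2.2), -s.1.2))
      map_add' := fun s t => by
        ext <;> simp only [Prod.fst_add, Prod.snd_add, Algebra.smul_def] <;> ring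
      map_smul' := fun k s => by
        ext <;> simp only [Prod.smul_fst, Prod.smul_snd, RingHom.id_apply] <;>
          simp only [Algebra.smul_def] <;> ring }
  let u : Module.End F ((R × R) × (R × R)) :=
    { toFun := fun s =>
        ((ω * s.1.2, s.1.1 + (a - c) • s.1.2), (ω * s.2.2, s.2.1 + (a - c) • s.2.2))
      map_add' := fun s t => by
        ext <;> simp only [Prod.fst_add, Prod.snd_add, Algebra.smul_def] <;> ring
      map_smul' := fun k s => by
        ext <;> simp only [Prod.smul_fst, Prod.smul_snd, RingHom.id_apply] <;>
          simp only [Algebra.smul_def] <;> ring }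
  have hu : (symplecticExtension v).endo = E.conjAlgEquiv F u := by
    apply LinearMap.ext
    intro m
    obtain ⟨s, rfl⟩ := E.surjective m
    rw [LinearEquiv.conjAlgEquiv_apply]
    simp only [LinearMap.comp_apply, LinearEquiv.coe_coe, LinearEquiv.symm_apply_apply]
    refine Prod.ext ?_ ?_
    · exact he s.1.1 s.1.2
    · refine LinearMap.ext fun x => ?_
      obtain ⟨⟨x, y⟩, rfl⟩ := e.surjective x
      change ψ s.2 (v (e (x, y))) = ψ _ (e (x, y))
      rw [he, hψ, hψ, e.symm_apply_apply, e.symm_apply_apply, hβ, hβ]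
      congr 1
      simp only [Algebra.smul_def]
      ring
  have hform : ∀ s t, (symplecticExtension v).form (E s) (E t) = β s.2 t.1 - β t.2 s.1 :=
    fun s t => by
      change ψ s.2 (e t.1) - ψ t.2 (e s.1) = _
      simp [hψ]
  have hw : ∀ m, (symplecticExtension v).form m (E.conjAlgEquiv F w m) = 0 := fun m => by
    obtain ⟨s, rfl⟩ := E.surjective m
    rw [LinearEquiv.conjAlgEquiv_apply]
    simp only [LinearMap.comp_apply, LinearEquiv.coe_coe, LinearEquiv.symm_apply_apply]
    rw [hform, hβ, hβ, ← map_sub, ← map_zero l]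
    congr 1
    simp only [w, LinearMap.coe_mk, AddHom.coe_mk, Algebra.smul_def, map_sub]
    ring
  have hq : aeval (w - u) (X ^ 2 - C c * X + C d) = 0 := by
    apply LinearMap.ext
    intro s
    simp only [map_add, map_sub, map_mul, aeval_X, aeval_C, pow_two,
      Module.algebraMap_end_eq_smul_id]
    ext <;> simp [w, u, Algebra.smul_def] <;> ring
  have hp : aeval w (X ^ 2 - C a * X + C b) = 0 := by
    apply LinearMap.ext
    intro s
    simp only [map_add, map_sub, map_mul, aeval_X, aeval_C, pow_two,
      Module.algebraMap_end_eq_smul_id]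
    ext <;> simp [w, Algebra.smul_def] <;> ring
  refine ⟨E.conjAlgEquiv F w, E.conjAlgEquiv F (w - u), hw, fun m => ?_, ?_, ?_, ?_⟩
  · have h := (symplecticExtension v).endo_alt m
    rw [hu] at h
    rw [map_sub, LinearMap.sub_apply, map_sub, hw, h, sub_zero]
  · rw [aeval_algEquiv]; simp [hp]
  · rw [aeval_algEquiv]; simp only [AlgHom.comp_apply, hq, map_zero]
  · rw [hu, map_sub, sub_sub_cancel]

/-! ### Quotients of F[t] as Frobenius algebras and free modules of rank 2 -/

/-- The linear form on `F[t] / (G)` extracting the coefficient of degree `deg G - 1` is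
a Frobenius form. -/
theorem AdjoinRoot.exists_nondegenerate_form {F : Type*} [Field F] {G : F[X]} (hG : G.Monic) :
    ∃ l : AdjoinRoot G →ₗ[F] F, ∀ x, (∀ y, l (x * y) = 0) → x = 0 := by
  refine ⟨lcoeff F (G.natDegree - 1) ∘ₗ AdjoinRoot.modByMonicHom hG, fun x hx => ?_⟩
  obtain ⟨f, rfl⟩ := AdjoinRoot.mk_surjective x
  rw [← AdjoinRoot.mk_leftInverse hG (AdjoinRoot.mk G f), AdjoinRoot.modByMonicHom_mk] at hx ⊢
  have hdeg := degree_modByMonic_lt f hG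
  generalize f %ₘ G = g at hx hdeg
  by_contra hne
  have hg : g ≠ 0 := fun h => hne (by simp [h])
  have hlt : g.natDegree < G.natDegree := natDegree_lt_natDegree hg hdeg
  -- This shift puts the leading coefficient of `g` in degree deg G - 1, with no reduction modulo
  -- `G`.
  have := hx (AdjoinRoot.mk G (X ^ (G.natDegree - 1 - g.natDegree)))
  rw [← map_mul, LinearMap.comp_apply, AdjoinRoot.modByMonicHom_mk,
    (modByMonic_eq_self_iff hG).2, lcoeff_apply, coeff_mul_X_pow',
    if_pos (by omega)] at this
  · refine hg (leadingCoeff_eq_zero.1 ?_)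
    rwa [show G.natDegree - 1 - (G.natDegree - 1 - g.natDegree) = g.natDegree by omega] at this
  · refine degree_lt_degree ?_
    rw [natDegree_mul_X_pow _ hg]
    omega

/-- `F[t] / (G (t ^ 2 - δ t))` is free with basis `(1, t)` over `F[z] / (G)`,
with `z = t ^ 2 - δ t`. -/
theorem AdjoinRoot.exists_equiv_prod {F : Type*} [Field F] {G : F[X]} (hG : G.Monic) (δ : F) :
    ∃ e : (AdjoinRoot G × AdjoinRoot G) ≃ₗ[F] AdjoinRoot (G.comp (X ^ 2 - C δ * X)),
      ∀ x y, AdjoinRoot.root _ * e (x, y) = e (AdjoinRoot.root G * y, x + δ • y) := by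
  set h : F[X] := X ^ 2 - C δ * X with hh
  have hdeg : h.natDegree = 2 := by rw [hh]; compute_degree!
  have hmon : h.Monic := by rw [hh]; monicity!
  have hGh : (G.comp h).Monic := hG.comp hmon (by omega)
  let t : AdjoinRoot (G.comp h) := AdjoinRoot.root _
  let j : AdjoinRoot G →ₐ[F] AdjoinRoot (G.comp h) :=
    AdjoinRoot.liftAlgHom G (Algebra.ofId F _) (t ^ 2 - δ • t) (by
      have := AdjoinRoot.aeval_eq (f := G.comp h) (G.comp h)
      rw [AdjoinRoot.mk_self, aeval_comp] at this
      rw [← this]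
      simp [aeval_def, hh, t, Algebra.smul_def])
  have hj : j (AdjoinRoot.root G) = t ^ 2 - δ • t := by simp [j]
  let φ : (AdjoinRoot G × AdjoinRoot G) →ₗ[F] AdjoinRoot (G.comp h) :=
    j.toLinearMap.coprod (LinearMap.mulLeft F t ∘ₗ j.toLinearMap)
  have hφ : ∀ x y, φ (x, y) = j x + t * j y := fun _ _ => rfl
  have hmul : ∀ x y, t * φ (x, y) = φ (AdjoinRoot.root G * y, x + δ • y) := fun x y => by
    simp only [hφ, map_add, map_mul, map_smul, hj]
    simp only [Algebra.smul_def]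
    ring
  have hsurj : Function.Surjective φ := by
    intro m
    obtain ⟨f, rfl⟩ := AdjoinRoot.mk_surjective m
    induction f using Polynomial.induction_on' with
    | add f g hf hg =>
      obtain ⟨x, hx⟩ := hf
      obtain ⟨y, hy⟩ := hg
      exact ⟨x + y, by rw [map_add, hx, hy, map_add]⟩
    | monomial n k =>
      induction n with
      | zero => exact ⟨(algebraMap F _ k, 0), by rw [hφ, AlgHom.commutes, map_zero, mul_zero, add_zero]; rfl⟩
      | succ n ih =>
        obtain ⟨⟨x, y⟩, hx⟩ := ih
        refine ⟨_, (hmul x y).symm.trans ?_⟩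
        rw [hx, ← X_mul_monomial, map_mul, AdjoinRoot.mk_X]
  have := hG.finite_adjoinRoot
  have := hGh.finite_adjoinRoot
  have hfin : Module.finrank F (AdjoinRoot G × AdjoinRoot G)
      = Module.finrank F (AdjoinRoot (G.comp h)) := by
    rw [Module.finrank_prod, (AdjoinRoot.powerBasis' hG).finrank,
      (AdjoinRoot.powerBasis' hGh).finrank, AdjoinRoot.powerBasis'_dim,
      AdjoinRoot.powerBasis'_dim, natDegree_comp, hdeg]
    omega
  exact ⟨LinearEquiv.ofBijective φ ⟨(LinearMap.injective_iff_surjective_of_finrank_eq_finrank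
    hfin).2 hsurj, hsurj⟩, hmul⟩

/-! ### The fundamental polynomial and its factorization -/

theorem resultant_of_degree_two {R : Type*} [CommRing R] (f g : R[X]) (hf : f.coeff 2 = 1)
    (hg : g.coeff 2 = 1) :
    resultant f g 2 2 = (f.coeff 0 - g.coeff 0) ^ 2
      + (f.coeff 1 - g.coeff 1) * (f.coeff 1 * g.coeff 0 - f.coeff 0 * g.coeff 1) := by
  have : sylvester f g 2 2 = !![g.coeff 0, 0, f.coeff 0, 0; g.coeff 1, g.coeff 0, f.coeff 1, f.coeff 0;
      1, g.coeff 1, 1, f.coeff 1; 0, 1, 0, 1] := by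
    ext i j
    fin_cases i <;> fin_cases j <;> simp [sylvester, Fin.addCases, hf, hg]
  rw [resultant, this]
  simp [Matrix.det_succ_row_zero, Fin.sum_univ_succ, Fin.succAbove]
  ring

/-- Pairing x₁ - y₁ with x₂ - y₂ and x₁ - y₂ with x₂ - y₁ gives factors in z = t² - δt. The values
of z + b + d are x₁y₂ + x₂y₁ and x₁y₁ + x₂y₂, whose sum and product are the coefficients here. -/
theorem fundamentalPoly_eq {F : Type*} [Field F] (a b c d : F) :
    fundamentalPoly (X ^ 2 - C a * X + C b) (X ^ 2 - C c * X + C d) =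
      ((X + C (b + d)) ^ 2 - C (a * c) * (X + C (b + d))
        + C (d * (a ^ 2 - 2 * b) + b * (c ^ 2 - 2 * d))).comp (X ^ 2 - C (a - c) * X) := by
  have h1 : (X ^ 2 - C a * X + C b : F[X]).map (C : F →+* F[X])
      = X ^ 2 - C (C a) * X + C (C b) := by simp
  have h2 : ((X ^ 2 - C c * X + C d : F[X]).map (C : F →+* F[X])).comp (X - C X)
      = X ^ 2 - C (2 * X + C c) * X + C (X ^ 2 + C c * X + C d) := by
    simp only [Polynomial.map_add, Polynomial.map_sub, Polynomial.map_mul, Polynomial.map_pow,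
      map_X, map_C, add_comp, sub_comp, mul_comp, pow_comp, X_comp, C_comp, map_add, map_mul,
      map_pow, map_ofNat]
    ring
  have hdeg : ∀ s t : F[X], (X ^ 2 - C s * X + C t : F[X][X]).natDegree = 2 := fun s t => by
    compute_degree!
  have hc : ∀ s t : F[X], (X ^ 2 - C s * X + C t : F[X][X]).coeff 0 = t ∧
      (X ^ 2 - C s * X + C t : F[X][X]).coeff 1 = -s ∧
      (X ^ 2 - C s * X + C t : F[X][X]).coeff 2 = 1 := fun s t => by
    simp [coeff_X, coeff_C, coeff_X_pow]
  rw [fundamentalPoly, h1, h2, hdeg, hdeg, resultant_of_degree_two _ _ (hc _ _).2.2 (hc _ _).2.2,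
    (hc _ _).1, (hc _ _).1, (hc _ _).2.1, (hc _ _).2.1]
  simp only [add_comp, sub_comp, mul_comp, pow_comp, X_comp, C_comp, map_add, map_sub, map_mul,
    map_pow, map_ofNat, ofNat_comp]
  ring

/-- The other root is a - x, so a single root generates. -/
theorem splittingFieldIn_eq_adjoin_root {F K : Type*} [Field F] [Field K] [Algebra F K] (a b : F)
    (x : K) (hx : aeval x (X ^ 2 - C a * X + C b) = 0) :
    splittingFieldIn K (X ^ 2 - C a * X + C b) = IntermediateField.adjoin F {x} := by
  have hne : (X ^ 2 - C a * X + C b : F[X]) ≠ 0 := Monic.ne_zero (by monicity!)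
  refine le_antisymm (IntermediateField.adjoin_le_iff.2 fun y hy => ?_)
    (IntermediateField.adjoin.mono _ _ _ (by simpa [mem_rootSet, hne] using hx))
  have hxm := IntermediateField.mem_adjoin_simple_self F x
  have hy := (mem_rootSet.1 hy).2
  simp only [map_add, map_sub, map_mul, map_pow, aeval_X, aeval_C] at hx hy
  have : (y - x) * (y - (algebraMap F K a - x)) = 0 := by linear_combination hy - hx
  rcases mul_eq_zero.1 this with h | h
  · rw [sub_eq_zero.1 h]; exact hxm
  · rw [sub_eq_zero.1 h]; exact sub_mem (algebraMap_mem _ _) hxm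

theorem finrank_adjoin_root_of_irreducible {F K : Type*} [Field F] [Field K] [Algebra F K]
    (p : F[X]) (hp : p.Monic) (hirr : Irreducible p) (x : K) (hx : aeval x p = 0) :
    Module.finrank F (IntermediateField.adjoin F {x}) = p.natDegree := by
  rw [IntermediateField.adjoin.finrank ⟨p, hp, hx⟩, minpoly.eq_of_irreducible_of_monic hirr hx hp]

/-- For irreducible `p` and `q` with distinct splitting fields, `F_{p,q}` is a power of an irreducible polynomial
in `t ^ 2 - δ t`. -/
theorem exists_fundamentalPoly_eq_pow {F K : Type*} [Field F] [Field K] [Algebra F K]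
    (a b c d : F) (hp : Irreducible (X ^ 2 - C a * X + C b))
    (hq : Irreducible (X ^ 2 - C c * X + C d)) (x y : K)
    (hx : aeval x (X ^ 2 - C a * X + C b) = 0) (hy : aeval y (X ^ 2 - C c * X + C d) = 0)
    (hxy : IntermediateField.adjoin F {x} ≠ IntermediateField.adjoin F {y})
    (hcase : (2 : F) ≠ 0 ∨ (a = 0 ∧ c = 0) ∨ a ≠ c) :
    ∃ (ρ : F[X]) (m : ℕ), ρ.Monic ∧ Irreducible (ρ.comp (X ^ 2 - C (a - c) * X)) ∧
      fundamentalPoly (X ^ 2 - C a * X + C b) (X ^ 2 - C c * X + C d) =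
        (ρ.comp (X ^ 2 - C (a - c) * X)) ^ m := by
  have hdeg : ∀ s t : F, (X ^ 2 - C s * X + C t : F[X]).natDegree = 2 := fun s t => by
    compute_degree!
  have hmon : ∀ s t : F, (X ^ 2 - C s * X + C t : F[X]).Monic := fun s t => by monicity!
  have hfx := finrank_adjoin_root_of_irreducible _ (hmon a b) hp x hx
  have hfy := finrank_adjoin_root_of_irreducible _ (hmon c d) hq y hy
  rw [hdeg] at hfx hfy
  simp only [map_add, map_sub, map_mul, map_pow, aeval_X, aeval_C] at hx hy
  have hxm := IntermediateField.mem_adjoin_simple_self F x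
  have hym := IntermediateField.mem_adjoin_simple_self F y
  have : FiniteDimensional F (IntermediateField.adjoin F {x}) :=
    FiniteDimensional.of_finrank_pos (by omega)
  have : FiniteDimensional F (IntermediateField.adjoin F {y}) :=
    FiniteDimensional.of_finrank_pos (by omega)
  have hθ : ∀ k : F, algebraMap F K k ≠ x - y := fun k hk => hxy
    (IntermediateField.eq_of_le_of_finrank_eq (IntermediateField.adjoin_simple_le_iff.2 (by
      rw [show x = algebraMap F K k + y by rw [hk]; ring]
      exact add_mem (algebraMap_mem _ _) hym)) (hfx.trans hfy.symm))
  -- In this case the trace condition forces a = c = 0, and F_{p,q} = (t² + b + d)². Otherwise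
  -- F_{p,q} is itself irreducible, of degree 4.
  by_cases h : (2 : F) = 0 ∧ a = c
  · obtain ⟨h2, hac⟩ := h
    obtain ⟨rfl, rfl⟩ : a = 0 ∧ c = 0 := by tauto
    have h2K : (2 : K) = 0 := by rw [← map_ofNat (algebraMap F K) 2, h2, map_zero]
    have hcomp : (X + C (b + d)).comp (X ^ 2 - C ((0 : F) - 0) * X) = X ^ 2 + C (b + d) := by simp
    refine ⟨X + C (b + d), 2, monic_X_add_C _, ?_, ?_⟩
    · have hr : (X ^ 2 + C (b + d) : F[X]).Monic := by monicity!
      have hroot : aeval (x - y) (X ^ 2 + C (b + d)) = 0 := by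
        simp only [map_add, map_pow, aeval_X, aeval_C, map_zero] at hx hy ⊢
        linear_combination hx + hy - x * y * h2K
      have hint : IsIntegral F (x - y) := ⟨_, hr, hroot⟩
      rw [hcomp, eq_of_monic_of_dvd_of_natDegree_le (minpoly.monic hint) hr
        (minpoly.dvd F _ hroot)]
      · exact minpoly.irreducible hint
      · rw [show (X ^ 2 + C (b + d) : F[X]).natDegree = 2 by compute_degree!,
          minpoly.two_le_natDegree_iff hint]
        rintro ⟨k, hk⟩
        exact hθ k hk
    · rw [fundamentalPoly_eq]
      simp [h2]
  · refine ⟨_, 1, ?_, ?_, by rw [fundamentalPoly_eq, pow_one]⟩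
    · monicity!
    · set f : F[X] := Polynomial.comp _ _ with hf
      have hfdeg : f.natDegree = 4 := by
        rw [hf, natDegree_comp, show (X ^ 2 - C (a - c) * X : F[X]).natDegree = 2 by
          compute_degree!]
        rw [show (4 : ℕ) = 2 * 2 by rfl]
        congr 1
        compute_degree!
      have hfmon : f.Monic := by
        rw [hf]
        refine Monic.comp (by monicity!) (by monicity!) ?_
        rw [show (X ^ 2 - C (a - c) * X : F[X]).natDegree = 2 by compute_degree!]
        omega
      have hroot : aeval (x - y) f = 0 := by
        rw [hf, aeval_comp]
        simp only [map_add, map_sub, map_mul, map_pow, aeval_X, aeval_C, map_ofNat]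
        generalize algebraMap F K a = A at *
        generalize algebraMap F K b = B at *
        generalize algebraMap F K c = C' at *
        generalize algebraMap F K d = D at *
        obtain rfl : B = A * x - x ^ 2 := by linear_combination hx
        obtain rfl : D = C' * y - y ^ 2 := by linear_combination hy
        ring
      have hint : IsIntegral F (x - y) := ⟨_, hfmon, hroot⟩
      have hne : algebraMap F K (a - c) - 2 * (x - y) ≠ 0 := fun h0 => by
        by_cases h2 : (2 : F) = 0
        · have h2K : (2 : K) = 0 := by rw [← map_ofNat (algebraMap F K) 2, h2, map_zero]
          rw [h2K, zero_mul, sub_zero, map_eq_zero, sub_eq_zero] at h0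
          exact h ⟨h2, h0⟩
        · have h2K : (2 : K) ≠ 0 := by
            rw [← map_ofNat (algebraMap F K) 2]
            exact (_root_.map_ne_zero _).2 h2
          refine hθ ((a - c) / 2) ?_
          rw [map_div₀, map_ofNat, div_eq_iff h2K]
          linear_combination h0
      have hθm := IntermediateField.mem_adjoin_simple_self F (x - y)
      have hxθ : x ∈ IntermediateField.adjoin F {x - y} := by
        -- With θ = x - y, the quadratic terms of p(x) and q(x - θ) cancel, leaving a linear
        -- equation for x with coefficient ±(δ - 2θ).
        have : x = (algebraMap F K (b - d) + (x - y) * (algebraMap F K (a - c) - (x - y))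
            - algebraMap F K a * (x - y)) / (algebraMap F K (a - c) - 2 * (x - y)) := by
          rw [eq_div_iff hne]
          simp only [map_sub]
          linear_combination hy - hx
        have hmem := div_mem (sub_mem (add_mem (algebraMap_mem _ (b - d)) (mul_mem hθm
          (sub_mem (algebraMap_mem _ (a - c)) hθm))) (mul_mem (algebraMap_mem _ a) hθm))
          (sub_mem (algebraMap_mem _ (a - c)) (mul_mem (ofNat_mem _ 2) hθm))
        rwa [← this] at hmem
      have hyθ : y ∈ IntermediateField.adjoin F {x - y} := by
        simpa using sub_mem hxθ hθm
      have hlx := IntermediateField.adjoin_simple_le_iff.2 hxθ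
      have hly := IntermediateField.adjoin_simple_le_iff.2 hyθ
      have hfθ := IntermediateField.adjoin.finrank hint
      have hpos := minpoly.natDegree_pos hint
      have : FiniteDimensional F (IntermediateField.adjoin F {x - y}) :=
        FiniteDimensional.of_finrank_pos (by omega)
      -- The degree of θ is even, at most 4, and not 2, since F(θ) contains the distinct quadratic
      -- fields F(x) and F(y).
      have hn2 : (minpoly F (x - y)).natDegree ≠ 2 := fun h2 => hxy
        ((IntermediateField.eq_of_le_of_finrank_eq hlx (by omega)).trans
          (IntermediateField.eq_of_le_of_finrank_eq hly (by omega)).symm)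
      have hdvd : 2 ∣ (minpoly F (x - y)).natDegree := by
        rw [← hfx, ← hfθ]
        exact IntermediateField.finrank_dvd_of_le_right hlx
      rw [eq_of_monic_of_dvd_of_natDegree_le (minpoly.monic hint) hfmon
        (minpoly.dvd F _ hroot) (by omega)]
      exact minpoly.irreducible hint

/-! ### Structure of exceptional endomorphisms, and conclusion -/

/-- Recasts `AdjoinRoot.exists_equiv_prod` for the cyclic F[t]-modules produced by the primary
decomposition. -/
theorem AdjoinRoot.exists_equiv_quotient {F : Type*} [Field F] {G g : F[X]} (hG : G.Monic) (δ : F)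
    (hg : G.comp (X ^ 2 - C δ * X) = g) :
    ∃ e : (AdjoinRoot G × AdjoinRoot G) ≃ₗ[F] (F[X] ⧸ Submodule.span F[X] {g}),
      ∀ x y, (X : F[X]) • e (x, y) = e (AdjoinRoot.root G * y, x + δ • y) := by
  subst hg
  obtain ⟨e, he⟩ := AdjoinRoot.exists_equiv_prod hG δ
  refine ⟨e, fun x y => Eq.trans ?_ (he x y)⟩
  generalize e (x, y) = z
  obtain ⟨f, rfl⟩ := AdjoinRoot.mk_surjective z
  rfl

/-- If every vector is killed by a power of an irreducible `ρ (v ^ 2 - δ v)`, then `v` is similar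
to multiplication by `t` on `R[t] / (t ^ 2 - δ t - ω)` for some Frobenius algebra `R`. -/
theorem exists_frobenius_model {F V : Type*} [Field F] [AddCommGroup V] [Module F V]
    [FiniteDimensional F V] (v : Module.End F V) (δ : F) (ρ : F[X]) (hρ : ρ.Monic)
    (hirr : Irreducible (ρ.comp (X ^ 2 - C δ * X)))
    (hv : ∀ x, ∃ n, aeval v ((ρ.comp (X ^ 2 - C δ * X)) ^ n) x = 0) :
    ∃ (ι : Type) (_ : Fintype ι) (k : ι → ℕ) (ω : Π i, AdjoinRoot (ρ ^ k i))
      (l : (Π i, AdjoinRoot (ρ ^ k i)) →ₗ[F] F)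
      (e : ((Π i, AdjoinRoot (ρ ^ k i)) × (Π i, AdjoinRoot (ρ ^ k i))) ≃ₗ[F] V),
      (∀ x, (∀ y, l (x * y) = 0) → x = 0) ∧
        ∀ x y, v (e (x, y)) = e (ω * y, x + δ • y) := by
  set h : F[X] := X ^ 2 - C δ * X with hh
  have htors : Module.IsTorsion' (Module.AEval' v) (Submonoid.powers (ρ.comp h)) := by
    intro x
    obtain ⟨x, rfl⟩ := (Module.AEval'.of v).surjective x
    obtain ⟨n, hn⟩ := hv x
    refine ⟨⟨_, n, rfl⟩, ?_⟩
    change (ρ.comp h) ^ n • Module.AEval'.of v x = 0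
    rw [← Module.AEval.of_aeval_smul]
    change Module.AEval'.of v (aeval v ((ρ.comp h) ^ n) x) = 0
    rw [hn, map_zero]
  obtain ⟨m, k, ⟨g⟩⟩ := Module.torsion_by_prime_power_decomposition hirr htors
  have hpow : ∀ i, (ρ ^ k i).comp h = ρ.comp h ^ k i := fun i => by simp
  choose l hl using fun i => AdjoinRoot.exists_nondegenerate_form (hρ.pow (k i))
  choose e he using fun i => AdjoinRoot.exists_equiv_quotient (hρ.pow (k i)) δ (hpow i)
  let g' : (Π i, F[X] ⧸ Submodule.span F[X] {ρ.comp h ^ k i}) ≃ₗ[F[X]] Module.AEval' v :=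
    (DirectSum.linearEquivFunOnFintype F[X] _ _).symm ≪≫ₗ g.symm
  let P : ((Π i, AdjoinRoot (ρ ^ k i)) × (Π i, AdjoinRoot (ρ ^ k i))) ≃ₗ[F]
      (Π i, F[X] ⧸ Submodule.span F[X] {ρ.comp h ^ k i}) :=
    { toFun := fun s i => e i (s.1 i, s.2 i)
      invFun := fun s => (fun i => ((e i).symm (s i)).1, fun i => ((e i).symm (s i)).2)
      left_inv := fun s => by simp
      right_inv := fun s => by simp
      map_add' := fun s t => by
        funext i
        exact map_add (e i) (s.1 i, s.2 i) (t.1 i, t.2 i)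
      map_smul' := fun r s => by
        funext i
        exact map_smul (e i) r (s.1 i, s.2 i) }
  refine ⟨Fin m, inferInstance, k, fun i => AdjoinRoot.root _,
    ∑ i, l i ∘ₗ LinearMap.proj i,
    P ≪≫ₗ g'.restrictScalars F ≪≫ₗ (Module.AEval'.of v).symm, fun x hx => ?_, fun x y => ?_⟩
  · funext i
    refine hl i (x i) fun y => ?_
    have := hx (Pi.single i y)
    rw [LinearMap.sum_apply, Finset.sum_eq_single i] at this
    · simpa using this
    · intro j _ hj
      simp [Pi.single_eq_of_ne hj]
    · simp
  · have hX : P (fun i => AdjoinRoot.root _ * y i, x + δ • y) = (X : F[X]) • P (x, y) := by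
      funext i
      exact (he i (x i) (y i)).symm
    apply (Module.AEval'.of v).injective
    rw [← Module.AEval'.X_smul_of]
    simp only [LinearEquiv.trans_apply, LinearEquiv.apply_symm_apply]
    change (X : F[X]) • g' (P (x, y)) = g' (P (fun i => AdjoinRoot.root _ * y i, x + δ • y))
    rw [hX, map_smul]

theorem IsExceptional.exists_pow_apply_eq_zero {F V : Type*} [Field F] [AddCommGroup V]
    [Module F V] {p q : F[X]} {v : Module.End F V} (hv : IsExceptional p q v) (x : V) :
    ∃ n, aeval v (fundamentalPoly p q ^ n) x = 0 := by
  have hmono : Monotone fun n : ℕ => LinearMap.ker (aeval v (fundamentalPoly p q) ^ n) := by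
    intro m n hmn y hy
    obtain ⟨j, rfl⟩ := Nat.exists_eq_add_of_le' hmn
    rw [LinearMap.mem_ker] at hy ⊢
    rw [pow_add, Module.End.mul_apply, hy, map_zero]
  have hx : x ∈ exceptionalPart p q v := by rw [hv]; trivial
  obtain ⟨n, hn⟩ := (Submodule.mem_iSup_of_directed _ hmono.directed_le).1 hx
  exact ⟨n, by simpa using hn⟩

theorem Polynomial.Monic.eq_quadratic {F : Type*} [Field F] {p : F[X]} (hp : p.Monic)
    (hp2 : p.natDegree = 2) : p = X ^ 2 - C (polyTrace p) * X + C (p.coeff 0) := by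
  have h1 : p.coeff 2 = 1 := hp2 ▸ hp
  rw [polyTrace, nextCoeff_of_natDegree_pos (by omega), hp2]
  nth_rw 1 [p.as_sum_range_C_mul_X_pow]
  simp [hp2, Finset.sum_range_succ, h1]
  ring

theorem mainTheorem8 {F K V : Type*} [Field F] [Field K] [Algebra F K] [IsAlgClosure F K]
    [AddCommGroup V] [Module F V] [FiniteDimensional F V]
    (p q : F[X]) (hp : p.Monic) (hq : q.Monic) (hp2 : p.natDegree = 2) (hq2 : q.natDegree = 2)
    (hp_irr : Irreducible p) (hq_irr : Irreducible q)
    (hsplit : splittingFieldIn K p ≠ splittingFieldIn K q)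
    (hcase : ringChar F ≠ 2 ∨ (polyTrace p = 0 ∧ polyTrace q = 0) ∨ polyTrace p ≠ polyTrace q)
    (v : Module.End F V) (hv : IsExceptional p q v) :
    (symplecticExtension v).IsDifference p q := by
  have hcase' : (2 : F) ≠ 0 ∨ (polyTrace p = 0 ∧ polyTrace q = 0) ∨ polyTrace p ≠ polyTrace q :=
    hcase.imp_left fun h h2 => h (CharP.ringChar_of_prime_eq_zero Nat.prime_two (by simpa using h2))
  have hpe := hp.eq_quadratic hp2
  have hqe := hq.eq_quadratic hq2
  generalize polyTrace p = a, p.coeff 0 = b at hpe hcase'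
  generalize polyTrace q = c, q.coeff 0 = d at hqe hcase'
  clear hcase
  subst hpe hqe
  have : IsAlgClosed K := IsAlgClosure.isAlgClosed F
  obtain ⟨x, hx⟩ := IsAlgClosed.exists_aeval_eq_zero K _ hp_irr.degree_pos.ne'
  obtain ⟨y, hy⟩ := IsAlgClosed.exists_aeval_eq_zero K _ hq_irr.degree_pos.ne'
  rw [splittingFieldIn_eq_adjoin_root a b x hx, splittingFieldIn_eq_adjoin_root c d y hy]
    at hsplit
  obtain ⟨ρ, m, hρ, hirr, hpow⟩ :=
    exists_fundamentalPoly_eq_pow a b c d hp_irr hq_irr x y hx hy hsplit hcase'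
  obtain ⟨ι, _, k, ω, l, e, hl, he⟩ := exists_frobenius_model v (a - c) ρ hρ hirr fun z => by
    obtain ⟨n, hn⟩ := hv.exists_pow_apply_eq_zero z
    exact ⟨m * n, by rwa [pow_mul, ← hpow]⟩
  exact symplecticExtension_isDifference_of_equiv a b c d ω l hl v e he
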